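/- Let $d\in\mathbb N$, let $\rho\in\mathbb R^d$ with $\rho_i>0$ for all $i$ and $|\rho|=\rho_1+\dots+\rho_d<1$, put $\boldsymbol\rho=(\rho,1-|\rho|)\in\mathbb R^{d+1}$, and let $0\le n\le m\le N$ be integers. For an integer $M\ge 0$ put $\mathbb Z_M^{d+1}=\{\alpha\in\mathbb N_0^{d+1}:\alpha_1+\dots+\alpha_{d+1}=M\}$. For polynomials $f,g$ in the variables $x_1,\dots,x_d$, evaluated on $\mathbb Z_N^{d+1}$ through the first $d$ coordinates, let $$\langle f,g\rangle_{\mathsf K_{\rho,N}}=c\sum_{x\in\mathbb Z_N^{d+1}}f(x)g(x)\,\frac{\boldsymbol\rho^{x}}{x!},$$ where $c>0$ is an arbitrary normalization constant ($c=N!$ gives $\langle 1,1\rangle=1$). Let $\mathcal V_n^d(\mathsf K_{\rho,N})$ be the space of polynomials of total degree at most $n$ in $x_1,\dots,x_d$ that are orthogonal to all polynomials of total degree less than $n$. With $(a)_k=a(a+1)\cdots(a+k-1)$, for $\alpha\in\mathbb Z_m^{d+1}$ let $$\mathrm m_\alpha(x)=(-1)^{|\alpha|}\prod_{i=1}^{d+1}(-x_i)_{\alpha_i},\qquad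 x_{d+1}=N-x_1-\dots-x_d,$$ and let $$\mathsf L_{\alpha,n}(\cdot;\rho,N)=\boldsymbol\rho^{-\alpha}\,\mathrm{proj}_{\mathcal V_n^d(\mathsf K_{\rho,N})}\mathrm m_\alpha$$ be the projected monic Krawtchouk polynomial, where $\mathrm{proj}$ is the orthogonal projection. Put $$D=\frac{N!}{c}\cdot\frac{(-N)_n\,m!}{(-m)_n\,[(-N)_m]^2}.$$ Then $D>0$, and for every $f\in\mathcal V_n^d(\mathsf K_{\rho,N})$ $$f=D\sum_{|\alpha|=m}\frac{\boldsymbol\rho^{\alpha}}{\alpha!}\,\big\langle f,\mathsf L_{\alpha,n}(\cdot;\rho,N)\big\rangle_{\mathsf K_{\rho,N}}\,\mathsf L_{\alpha,n}(\cdot;\rho,N)$$ and $$\langle f,f\rangle_{\mathsf K_{\rho,N}}=D\sum_{|\alpha|=m}\frac{\boldsymbol\rho^{\alpha}}{\alpha!}\,\big\langle f,\mathsf L_{\alpha,n}(\cdot;\rho,N)\big\rangle_{\mathsf K_{\rho,N}}^2 .$$ In particular, the vectors $v_\alpha=\sqrt{D\,\boldsymbol\rho^{\alpha}/\alpha!}\;\mathsf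 L_{\alpha,n}(\cdot;\rho,N)$, $|\alpha|=m$, form a (Parseval) tight frame of $\mathcal V_n^d(\mathsf K_{\rho,N})$: they lie in this space, and $\langle f,f\rangle_{\mathsf K_{\rho,N}}=\sum_{|\alpha|=m}\langle f,v_\alpha\rangle_{\mathsf K_{\rho,N}}^2$ for all $f$ in it. -/

import Mathlib

/-- The grid `ℤ_N^{d+1}` of all `x ∈ ℕ^{d+1}` with `x₁ + ⋯ + x_{d+1} = N`. -/
def simplexGrid (d N : ℕ) : Finset (Fin (d + 1) → ℕ) :=
  Finset.piAntidiag Finset.univ N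

/-- The Pochhammer symbol `(a)_k = a (a + 1) ⋯ (a + k - 1)`. -/
noncomputable def poch (a : ℝ) (k : ℕ) : ℝ :=
  (ascPochhammer ℝ k).eval a

/-- The extended parameter vector `𝛒 = (ρ₁, …, ρ_d, 1 - |ρ|)`. -/
noncomputable def extParam {d : ℕ} (ρ : Fin d → ℝ) : Fin (d + 1) → ℝ :=
  Fin.snoc (α := fun _ => ℝ) ρ (1 - ∑ i, ρ i)

/-- `y^α = ∏ i, y_i ^ α_i`. -/
noncomputable def multiPow {d : ℕ} (y : Fin (d + 1) → ℝ) (α : Fin (d + 1) → ℕ) : ℝ :=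
  ∏ i, y i ^ α i

/-- `α! = ∏ i, (α_i)!`. -/
noncomputable def multiFactorial {d : ℕ} (α : Fin (d + 1) → ℕ) : ℝ :=
  ∏ i, ((α i).factorial : ℝ)

/-- The value of a polynomial in the `d` variables `x₁, …, x_d` at a point
`x = (x₁, …, x_d, x_{d+1})` of the grid. -/
noncomputable def gridEval {d : ℕ} (f : MvPolynomial (Fin d) ℝ) (x : Fin (d + 1) → ℕ) : ℝ :=
  MvPolynomial.eval (fun i : Fin d => (x i.castSucc : ℝ)) f

/-- The Krawtchouk weight `K_ρ(x) = 𝛒^x / x!`. -/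
noncomputable def krawtchoukWeight {d : ℕ} (ρ : Fin d → ℝ) (x : Fin (d + 1) → ℕ) : ℝ :=
  multiPow (extParam ρ) x / multiFactorial x

/-- The Krawtchouk inner product `⟨f, g⟩ = c ∑_{x ∈ ℤ_N^{d+1}} f(x) g(x) K_ρ(x)`, where `c` is the
normalization constant (`c = N!` turns the weight into the multinomial probability weights). -/
noncomputable def krawtchoukInner {d : ℕ} (c : ℝ) (ρ : Fin d → ℝ) (N : ℕ)
    (f g : MvPolynomial (Fin d) ℝ) : ℝ :=
  c * ∑ x ∈ simplexGrid d N, gridEval f x * gridEval g x * krawtchoukWeight ρ x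

/-- The Krawtchouk inner product as a bilinear form. -/
noncomputable def krawtchoukForm {d : ℕ} (c : ℝ) (ρ : Fin d → ℝ) (N : ℕ) :
    LinearMap.BilinForm ℝ (MvPolynomial (Fin d) ℝ) :=
  LinearMap.mk₂ ℝ (krawtchoukInner c ρ N)
    (by
      intro f f' g
      simp only [krawtchoukInner, gridEval, map_add, add_mul, Finset.sum_add_distrib, mul_add])
    (by
      intro a f g
      simp only [krawtchoukInner, gridEval, MvPolynomial.smul_eval, smul_eq_mul, Finset.mul_sum]
      exact Finset.sum_congr rfl fun x _ => by ring)
    (by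
      intro f g g'
      simp only [krawtchoukInner, gridEval, map_add, add_mul, Finset.sum_add_distrib, mul_add])
    (by
      intro a f g
      simp only [krawtchoukInner, gridEval, MvPolynomial.smul_eval, smul_eq_mul, Finset.mul_sum]
      exact Finset.sum_congr rfl fun x _ => by ring)

/-- The space `V_n^d(K_{ρ,N})` of orthogonal polynomials of degree `n` in `d` variables: polynomials
of total degree at most `n` that are orthogonal to every polynomial of total degree less than `n`
(for `n = 0` the second condition is empty). -/
noncomputable def krawtchoukSpace {d : ℕ} (c : ℝ) (ρ : Fin d → ℝ) (N n : ℕ) :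
    Submodule ℝ (MvPolynomial (Fin d) ℝ) where
  carrier := {p | p.totalDegree ≤ n ∧
    ∀ q : MvPolynomial (Fin d) ℝ, q.totalDegree < n → krawtchoukInner c ρ N p q = 0}
  zero_mem' := by
    refine ⟨by simp, fun q _ => ?_⟩
    exact LinearMap.map_zero₂ (krawtchoukForm c ρ N) q
  add_mem' := by
    rintro p p' ⟨h1, h2⟩ ⟨h1', h2'⟩
    refine ⟨(MvPolynomial.totalDegree_add p p').trans (max_le h1 h1'), fun q hq => ?_⟩
    have h := LinearMap.map_add₂ (krawtchoukForm c ρ N) p p' q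
    change krawtchoukInner c ρ N (p + p') q
      = krawtchoukInner c ρ N p q + krawtchoukInner c ρ N p' q at h
    rw [h, h2 q hq, h2' q hq, add_zero]
  smul_mem' := by
    rintro a p ⟨h1, h2⟩
    refine ⟨(MvPolynomial.totalDegree_smul_le a p).trans h1, fun q hq => ?_⟩
    have h := LinearMap.map_smul₂ (krawtchoukForm c ρ N) a p q
    change krawtchoukInner c ρ N (a • p) q = a • krawtchoukInner c ρ N p q at h
    rw [h, h2 q hq, smul_zero]

/-- `q` is the orthogonal projection of `p` onto `V_n^d(K_{ρ,N})`. -/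
def IsKrawtchoukProj {d : ℕ} (c : ℝ) (ρ : Fin d → ℝ) (N n : ℕ)
    (p q : MvPolynomial (Fin d) ℝ) : Prop :=
  q ∈ krawtchoukSpace c ρ N n ∧
    ∀ r ∈ krawtchoukSpace c ρ N n, krawtchoukInner c ρ N (p - q) r = 0

/-- The grid determines the polynomials of total degree at most `N`. -/
theorem eq_zero_of_gridEval_eq_zero {d N : ℕ} {p : MvPolynomial (Fin d) ℝ}
    (hp : p.totalDegree ≤ N) (h : ∀ x ∈ simplexGrid d N, gridEval p x = 0) : p = 0 := by
  by_contra hne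
  obtain ⟨t, ht, htd⟩ : ∃ t ∈ p.support, p.totalDegree = t.degree := by
    obtain ⟨t, ht, h'⟩ := Finset.exists_mem_eq_sup p.support
      (MvPolynomial.support_nonempty.mpr hne) (fun s => s.sum fun _ e => e)
    exact ⟨t, ht, h'⟩
  obtain ⟨s, hs, hs'⟩ := MvPolynomial.combinatorial_nullstellensatz_exists_eval_nonzero p t
    (MvPolynomial.mem_support_iff.mp ht) htd
    (fun i => (Finset.range (t i + 1)).image (fun k : ℕ => (k : ℝ)))
    (fun i => by
      rw [Finset.card_image_of_injective _ Nat.cast_injective, Finset.card_range]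
      exact Nat.lt_succ_self _)
  have hs2 : ∀ i, ∃ k : ℕ, k ≤ t i ∧ (k : ℝ) = s i := by
    intro i
    obtain ⟨k, hk, hk'⟩ := Finset.mem_image.mp (hs i)
    exact ⟨k, Nat.lt_succ_iff.mp (Finset.mem_range.mp hk), hk'⟩
  choose k hk hks using hs2
  have hsum : ∑ i, k i ≤ N := by
    calc ∑ i, k i ≤ ∑ i, t i := Finset.sum_le_sum fun i _ => hk i
      _ = t.degree := (Finsupp.degree_eq_sum t).symm
      _ ≤ N := htd ▸ hp
  have hx := h (Fin.snoc (α := fun _ => ℕ) k (N - ∑ i, k i)) (by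
    simp only [simplexGrid, Finset.mem_piAntidiag, Fin.sum_univ_castSucc, Fin.snoc_castSucc,
      Fin.snoc_last]
    exact ⟨by omega, fun i _ => Finset.mem_univ i⟩)
  apply hs'
  simpa [gridEval, hks] using hx

theorem extParam_pos {d : ℕ} {ρ : Fin d → ℝ} (hρ : ∀ i, 0 < ρ i) (hρ' : ∑ i, ρ i < 1)
    (i : Fin (d + 1)) : 0 < extParam ρ i := by
  unfold extParam
  refine Fin.lastCases ?_ (fun j => ?_) i
  · simpa using hρ'
  · simpa using hρ j

theorem krawtchoukWeight_pos {d : ℕ} {ρ : Fin d → ℝ} (hρ : ∀ i, 0 < ρ i) (hρ' : ∑ i, ρ i < 1)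
    (x : Fin (d + 1) → ℕ) : 0 < krawtchoukWeight ρ x :=
  div_pos (Finset.prod_pos fun i _ => pow_pos (extParam_pos hρ hρ' i) _)
    (Finset.prod_pos fun i _ => by exact_mod_cast Nat.factorial_pos _)

/-- The Krawtchouk inner product is positive definite on polynomials of degree at most `N`. -/
theorem eq_zero_of_krawtchoukInner_self {d N : ℕ} {c : ℝ} {ρ : Fin d → ℝ} (hc : 0 < c)
    (hρ : ∀ i, 0 < ρ i) (hρ' : ∑ i, ρ i < 1) {p : MvPolynomial (Fin d) ℝ}
    (hp : p.totalDegree ≤ N) (h : krawtchoukInner c ρ N p p = 0) : p = 0 := by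
  refine eq_zero_of_gridEval_eq_zero hp fun x hx => ?_
  have h0 := (mul_eq_zero.mp h).resolve_left hc.ne'
  rw [Finset.sum_eq_zero_iff_of_nonneg fun y _ =>
    mul_nonneg (mul_self_nonneg _) (krawtchoukWeight_pos hρ hρ' y).le] at h0
  have h1 := h0 x hx
  exact mul_self_eq_zero.mp ((mul_eq_zero.mp h1).resolve_right (krawtchoukWeight_pos hρ hρ' x).ne')

/-- Every polynomial has exactly one orthogonal projection onto `V_n^d(K_{ρ,N})`. -/
theorem existsUnique_krawtchoukProj {d N n : ℕ} {c : ℝ} {ρ : Fin d → ℝ} (hc : 0 < c)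
    (hρ : ∀ i, 0 < ρ i) (hρ' : ∑ i, ρ i < 1) (hn : n ≤ N) (p : MvPolynomial (Fin d) ℝ) :
    ∃! q, IsKrawtchoukProj c ρ N n p q := by
  have key : ∀ v ∈ krawtchoukSpace c ρ N n,
      (∀ r ∈ krawtchoukSpace c ρ N n, krawtchoukInner c ρ N v r = 0) → v = 0 := fun v hv h =>
    eq_zero_of_krawtchoukInner_self hc hρ hρ' (hv.1.trans hn) (h v hv)
  have hle : krawtchoukSpace c ρ N n ≤ MvPolynomial.restrictTotalDegree (Fin d) ℝ n := fun v hv =>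
    (MvPolynomial.mem_restrictTotalDegree (Fin d) n v).mpr hv.1
  have : FiniteDimensional ℝ (krawtchoukSpace c ρ N n) := Submodule.finiteDimensional_of_le hle
  let V := krawtchoukSpace c ρ N n
  let T : V →ₗ[ℝ] Module.Dual ℝ V := (krawtchoukForm c ρ N).domRestrict₁₂ V V
  have hT : Function.Injective T := by
    rw [← LinearMap.ker_eq_bot, LinearMap.ker_eq_bot']
    intro v hv
    have := key v.1 v.2 fun r hr => LinearMap.congr_fun hv (⟨r, hr⟩ : V)
    exact Subtype.ext this
  have hsurj : Function.Surjective T :=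
    (LinearMap.injective_iff_surjective_of_finrank_eq_finrank
      (Subspace.dual_finrank_eq).symm).mp hT
  obtain ⟨q, hq⟩ := hsurj ((krawtchoukForm c ρ N p).domRestrict V)
  refine ⟨q.1, ⟨q.2, fun r hr => ?_⟩, ?_⟩
  · have h1 : krawtchoukInner c ρ N q.1 r = krawtchoukInner c ρ N p r :=
      LinearMap.congr_fun hq (⟨r, hr⟩ : V)
    have h2 := LinearMap.map_sub₂ (krawtchoukForm c ρ N) p q.1 r
    change krawtchoukInner c ρ N (p - q.1) r
      = krawtchoukInner c ρ N p r - krawtchoukInner c ρ N q.1 r at h2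
    rw [h2, h1, sub_self]
  · rintro q' ⟨hq', h'⟩
    refine sub_eq_zero.mp (key _ (V.sub_mem hq' q.2) fun r hr => ?_)
    have h1 : krawtchoukInner c ρ N q.1 r = krawtchoukInner c ρ N p r :=
      LinearMap.congr_fun hq (⟨r, hr⟩ : V)
    have h2 := LinearMap.map_sub₂ (krawtchoukForm c ρ N) p q' r
    change krawtchoukInner c ρ N (p - q') r
      = krawtchoukInner c ρ N p r - krawtchoukInner c ρ N q' r at h2
    have h3 := LinearMap.map_sub₂ (krawtchoukForm c ρ N) q' q.1 r
    change krawtchoukInner c ρ N (q' - q.1) r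
      = krawtchoukInner c ρ N q' r - krawtchoukInner c ρ N q.1 r at h3
    have h4 := h' r hr
    linarith

open Classical in
/-- The orthogonal projection onto `V_n^d(K_{ρ,N})`; it exists and is unique for `n ≤ N` and
admissible `c`, `ρ` by `existsUnique_krawtchoukProj`. -/
noncomputable def krawtchoukProj {d : ℕ} (c : ℝ) (ρ : Fin d → ℝ) (N n : ℕ)
    (p : MvPolynomial (Fin d) ℝ) : MvPolynomial (Fin d) ℝ :=
  if h : ∃ q, IsKrawtchoukProj c ρ N n p q then h.choose else 0

theorem krawtchoukProj_spec {d N n : ℕ} {c : ℝ} {ρ : Fin d → ℝ} (hc : 0 < c)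
    (hρ : ∀ i, 0 < ρ i) (hρ' : ∑ i, ρ i < 1) (hn : n ≤ N) (p : MvPolynomial (Fin d) ℝ) :
    IsKrawtchoukProj c ρ N n p (krawtchoukProj c ρ N n p) := by
  have h := (existsUnique_krawtchoukProj hc hρ hρ' hn p).exists
  rw [krawtchoukProj, dif_pos h]
  exact h.choose_spec

/-- The homogeneous coordinates `(x₁, …, x_d, N - x₁ - ⋯ - x_d)` on the grid, as polynomials. -/
noncomputable def homCoord (d N : ℕ) : Fin (d + 1) → MvPolynomial (Fin d) ℝ :=
  Fin.snoc (α := fun _ => MvPolynomial (Fin d) ℝ) (fun i => MvPolynomial.X i)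
    (MvPolynomial.C (N : ℝ) - ∑ i, MvPolynomial.X i)

/-- The shifted monomial `m_α(x) = (-1)^{|α|} (-x)_α = (-1)^{|α|} ∏ i, (-x_i)_{α_i}` on the grid, as
a polynomial in `x₁, …, x_d`. -/
noncomputable def shiftedMonomial {d : ℕ} (N : ℕ) (α : Fin (d + 1) → ℕ) :
    MvPolynomial (Fin d) ℝ :=
  (-1) ^ (∑ i, α i) * ∏ i, Polynomial.aeval (-homCoord d N i) (ascPochhammer ℝ (α i))

theorem gridEval_shiftedMonomial {d N : ℕ} (α x : Fin (d + 1) → ℕ) (hx : x ∈ simplexGrid d N) :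
    gridEval (shiftedMonomial N α) x = (-1) ^ (∑ i, α i) * ∏ i, poch (-(x i : ℝ)) (α i) := by
  have hN : (N : ℝ) = ∑ i : Fin d, (x i.castSucc : ℝ) + x (Fin.last d) := by
    have := (Finset.mem_piAntidiag.mp hx).1
    rw [Fin.sum_univ_castSucc] at this
    exact_mod_cast this.symm
  have hc : ∀ i, MvPolynomial.eval (fun j : Fin d => (x j.castSucc : ℝ)) (homCoord d N i)
      = (x i : ℝ) := by
    intro i
    refine Fin.lastCases ?_ (fun j => ?_) i
    · simp [homCoord, hN]
    · simp [homCoord]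
  simp only [gridEval, shiftedMonomial, map_mul, map_pow, map_neg, map_one, map_prod]
  congr 1
  refine Finset.prod_congr rfl fun i _ => ?_
  rw [poch, ← hc i, ← map_neg, Polynomial.aeval_def, Polynomial.hom_eval₂,
    ← Polynomial.eval₂_id]
  congr 1
  ext a
  simp

/-- The projected monic Krawtchouk polynomial `L_{α,n} = 𝛒^{-α} proj_{V_n^d(K_{ρ,N})} m_α`. -/
noncomputable def krawtchoukL {d : ℕ} (c : ℝ) (ρ : Fin d → ℝ) (N n : ℕ)
    (α : Fin (d + 1) → ℕ) : MvPolynomial (Fin d) ℝ :=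
  (multiPow (extParam ρ) α)⁻¹ • krawtchoukProj c ρ N n (shiftedMonomial N α)

/-- The frame constant `(N! / c) · (-N)_n m! / ((-m)_n ((-N)_m)²)`. -/
noncomputable def krawtchoukFrameConst (c : ℝ) (N m n : ℕ) : ℝ :=
  ((N.factorial : ℝ) / c) *
    (poch (-(N : ℝ)) n * (m.factorial : ℝ) / (poch (-(m : ℝ)) n * poch (-(N : ℝ)) m ^ 2))

/-- The finite family `(v_k)_{k ∈ s}` is a (Parseval) tight frame of the space `V` with respect to
the form `B`: all `v_k` lie in `V`, and `B(v, v) = ∑_{k ∈ s} B(v, v_k)²` for all `v ∈ V`. -/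
def IsTightFrame {E ι : Type*} [AddCommGroup E] [Module ℝ E] (B : E → E → ℝ)
    (V : Submodule ℝ E) (s : Finset ι) (v : ι → E) : Prop :=
  (∀ k ∈ s, v k ∈ V) ∧ ∀ w ∈ V, B w w = ∑ k ∈ s, B w (v k) ^ 2

/-! Write `W` for the weight, `C_β(x) = ∏ i, (x_i choose β_i)` and `S_α(g) = ∑ x, g(x) C_α(x) W(x)`.
On the grid `m_α = α! C_α`. An element of `V_n` does not see the projection in `L_{α,n}`, so `⟨f,
L_{α,n}⟩ = c W(α)⁻¹ S_α(f)`. Both expansions therefore follow from the polarized identity that `∑ α,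
W(α)⁻¹ S_α(f) S_α(r)` is a constant multiple of `∑ x, f(x) r(x) W(x)` for `f, r ∈ V_n`.

This identity holds for every `g` of degree at most `n` in place of `f`, so `g = C_β` with `|β| ≤ n`
may be assumed. Shifting by `α` gives `S_α(g) = W(α) ∑ z, g(α + z) W(z)` over `|z| = N - m`, which
cancels `W(α)⁻¹`. For fixed `z`, Vandermonde expands `C_β(α + z)` in the `C_γ(α)` with `γ ≤ β`, and
`∑ α, C_γ(α) C_α(x)` is a multiple of `C_γ(x)`. Orthogonality of `r` to lower degrees kills every
term except `γ = β`, `|β| = n`, which no longer depends on `z`. The remaining sum of `W(z)` is `1 /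
(N - m)!` (`sum_multiChoose_add_mul`, `sum_div_krawtchoukWeight`).

The frame constant is the inverse of the resulting factor. The expansion of `f` itself then follows
because the form is definite in degree at most `N`. -/

/-! ### Binomial identities and weighted sums on the grid -/

/-- The multivariate Vandermonde convolution. -/
theorem sum_piAntidiag_prod_choose {ι : Type*} [DecidableEq ι] (s : Finset ι) (y : ι → ℕ) (k : ℕ) :
    ∑ δ ∈ s.piAntidiag k, ∏ i ∈ s, (y i).choose (δ i) = (∑ i ∈ s, y i).choose k := by
  induction s using Finset.cons_induction generalizing k with
  | empty => cases k <;> simp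
  | cons i s hi ih =>
    rw [Finset.piAntidiag_cons, Finset.sum_disjiUnion, Finset.sum_cons, Nat.add_choose_eq]
    refine Finset.sum_congr rfl fun p _ => ?_
    rw [Finset.sum_map, ← ih, Finset.mul_sum]
    refine Finset.sum_congr rfl fun δ hδ => ?_
    -- `δ` is supported in `s`, and `i ∉ s`.
    have h0 : δ i = 0 := by
      by_contra h
      exact hi ((Finset.mem_piAntidiag.mp hδ).2 i h)
    rw [Finset.prod_cons]
    congr 1
    · simp [h0]
    · refine Finset.prod_congr rfl fun j hj => ?_
      have : j ≠ i := fun h => hi (h ▸ hj)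
      simp [this]

theorem mem_simplexGrid {d N : ℕ} {x : Fin (d + 1) → ℕ} :
    x ∈ simplexGrid d N ↔ ∑ i, x i = N := by
  simp [simplexGrid]

theorem sum_simplexGrid_translate {d N k : ℕ} {M : Type*} [AddCommMonoid M]
    (a : Fin (d + 1) → ℕ) (ha : ∑ i, a i + k = N) (F : (Fin (d + 1) → ℕ) → M)
    (hF : ∀ x, ¬ a ≤ x → F x = 0) :
    ∑ x ∈ simplexGrid d N, F x = ∑ z ∈ simplexGrid d k, F (a + z) := by
  symm
  refine Finset.sum_of_injOn (fun z => a + z) (add_right_injective a).injOn ?_ ?_ (fun _ _ => rfl)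
  · intro z hz
    rw [Finset.mem_coe, mem_simplexGrid] at *
    simp [Finset.sum_add_distrib, hz, ha]
  · intro x hx hx'
    refine hF x fun hax => hx' ⟨x - a, ?_, add_tsub_cancel_of_le hax⟩
    rw [Finset.mem_coe, mem_simplexGrid]
    rw [mem_simplexGrid] at hx
    have : ∑ i, a i + ∑ i, (x - a) i = ∑ i, x i := by
      rw [← Finset.sum_add_distrib]
      exact Finset.sum_congr rfl fun i _ => add_tsub_cancel_of_le (hax i)
    omega

/-- The product of binomial coefficients `∏ i, (x_i choose β_i)`. -/
def multiChoose {d : ℕ} (β x : Fin (d + 1) → ℕ) : ℕ :=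
  ∏ i, (x i).choose (β i)

theorem multiChoose_eq_zero {d : ℕ} {β x : Fin (d + 1) → ℕ} (h : ¬ β ≤ x) :
    multiChoose β x = 0 := by
  obtain ⟨i, hi⟩ := not_forall.mp h
  exact Finset.prod_eq_zero (Finset.mem_univ i) (Nat.choose_eq_zero_of_lt (not_le.mp hi))

theorem multiChoose_add {d : ℕ} (β x z : Fin (d + 1) → ℕ) :
    multiChoose β (x + z) =
      ∑ q ∈ Fintype.piFinset fun i => Finset.HasAntidiagonal.antidiagonal (β i),
        multiChoose (fun i => (q i).1) x * multiChoose (fun i => (q i).2) z := by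
  simp only [multiChoose, Pi.add_apply, Nat.add_choose_eq, Finset.prod_univ_sum,
    Finset.prod_mul_distrib]

/-- Put `α = γ + δ`. Coordinatewise, choosing `α` from `x` and then `γ` from `α` is choosing `γ`
from `x` and then `δ` from `x - γ`; Vandermonde sums over `δ`. -/
theorem sum_simplexGrid_multiChoose_mul {d N m : ℕ} (γ x : Fin (d + 1) → ℕ)
    (hx : ∑ i, x i = N) (hγ : ∑ i, γ i ≤ m) :
    ∑ α ∈ simplexGrid d m, multiChoose γ α * multiChoose α x
      = (N - ∑ i, γ i).choose (m - ∑ i, γ i) * multiChoose γ x := by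
  rw [sum_simplexGrid_translate γ (Nat.add_sub_cancel' hγ) _ fun α h => by
    rw [multiChoose_eq_zero h, zero_mul]]
  have key : ∀ δ : Fin (d + 1) → ℕ, multiChoose γ (γ + δ) * multiChoose (γ + δ) x
      = multiChoose γ x * ∏ i, (x i - γ i).choose (δ i) := by
    intro δ
    simp only [multiChoose, ← Finset.prod_mul_distrib]
    refine Finset.prod_congr rfl fun i _ => ?_
    rw [mul_comm, Pi.add_apply, Nat.choose_mul (Nat.le_add_right _ _), Nat.add_sub_cancel_left]
  simp only [key]
  rw [← Finset.mul_sum, mul_comm]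
  -- Truncated subtraction gives `∑ (x_i - γ_i) = N - |γ|` only when `γ ≤ x`; otherwise the factor
  -- `C_γ(x)` vanishes.
  by_cases h : γ ≤ x
  · congr 1
    rw [simplexGrid, sum_piAntidiag_prod_choose, Finset.sum_tsub_distrib _ fun i _ => h i, hx]
  · rw [multiChoose_eq_zero h, mul_zero, mul_zero]

/-- The multinomial theorem for `(∑ y_i)^k = 1`, divided by `k!`. -/
theorem sum_simplexGrid_multiPow_div {d : ℕ} (y : Fin (d + 1) → ℝ) (hy : ∑ i, y i = 1) (k : ℕ) :
    ∑ z ∈ simplexGrid d k, multiPow y z / multiFactorial z = 1 / (k.factorial : ℝ) := by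
  have h := Finset.sum_pow_eq_sum_piAntidiag Finset.univ y k
  rw [hy, one_pow] at h
  rw [h, Finset.sum_div]
  refine Finset.sum_congr rfl fun z hz => ?_
  have hk : (k.factorial : ℝ) ≠ 0 := by positivity
  have hz' : multiFactorial z ≠ 0 := Finset.prod_ne_zero_iff.mpr fun i _ => by positivity
  have hm : multiFactorial z * (Nat.multinomial Finset.univ z : ℝ) = k.factorial := by
    have := Nat.multinomial_spec Finset.univ z
    rw [mem_simplexGrid.mp hz] at this
    rw [multiFactorial, ← this]
    push_cast
    rfl
  rw [div_eq_div_iff hz' hk, ← hm, multiPow]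
  ring

theorem sum_extParam {d : ℕ} (ρ : Fin d → ℝ) : ∑ i, extParam ρ i = 1 := by
  simp [extParam, Fin.sum_univ_castSucc]

theorem multiFactorial_pos {d : ℕ} (α : Fin (d + 1) → ℕ) : 0 < multiFactorial α :=
  Finset.prod_pos fun i _ => by positivity

theorem multiPow_pos {d : ℕ} {y : Fin (d + 1) → ℝ} (hy : ∀ i, 0 < y i) (α : Fin (d + 1) → ℕ) :
    0 < multiPow y α :=
  Finset.prod_pos fun i _ => pow_pos (hy i) _

/-- Only `x = α + z` contributes, and there `C_α(x) / x! = 1 / (α! z!)`, so the weight factors as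
`W(α) W(z)`. -/
theorem sum_simplexGrid_mul_multiChoose_mul_krawtchoukWeight {d N m : ℕ} (hmN : m ≤ N)
    (ρ : Fin d → ℝ) (g : (Fin (d + 1) → ℕ) → ℝ) {α : Fin (d + 1) → ℕ} (hα : α ∈ simplexGrid d m) :
    ∑ x ∈ simplexGrid d N, g x * multiChoose α x * krawtchoukWeight ρ x
      = krawtchoukWeight ρ α * ∑ z ∈ simplexGrid d (N - m), g (α + z) * krawtchoukWeight ρ z := by
  rw [mem_simplexGrid] at hα
  rw [sum_simplexGrid_translate (k := N - m) α (by omega) _ fun x h => by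
    rw [multiChoose_eq_zero h, Nat.cast_zero, mul_zero, zero_mul], Finset.mul_sum]
  refine Finset.sum_congr rfl fun z _ => ?_
  have h1 : multiPow (extParam ρ) (α + z) = multiPow (extParam ρ) α * multiPow (extParam ρ) z := by
    simp only [multiPow, Pi.add_apply, pow_add, Finset.prod_mul_distrib]
  have h2 : (multiChoose α (α + z) : ℝ) * multiFactorial α * multiFactorial z
      = multiFactorial (α + z) := by
    simp only [multiChoose, multiFactorial, Nat.cast_prod, ← Finset.prod_mul_distrib]
    refine Finset.prod_congr rfl fun i _ => ?_
    have := Nat.choose_mul_factorial_mul_factorial (Nat.le_add_right (α i) (z i))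
    rw [Nat.add_sub_cancel_left] at this
    exact_mod_cast this
  have ha := (multiFactorial_pos α).ne'
  have hz := (multiFactorial_pos z).ne'
  have haz := (multiFactorial_pos (α + z)).ne'
  simp only [krawtchoukWeight, h1]
  rw [← h2] at haz ⊢
  have hb : (multiChoose α (α + z) : ℝ) ≠ 0 := by
    intro h
    simp [h] at haz
  field_simp

/-! ### Polynomials as combinations of binomial products -/

/-- The span of the functions `∏ i, (x_i choose β_i)` with `|β| ≤ k`. -/
def multiChooseSpan (d k : ℕ) : Submodule ℝ ((Fin (d + 1) → ℕ) → ℝ) :=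
  Submodule.span ℝ ((fun β x => (multiChoose β x : ℝ)) '' {β | ∑ i, β i ≤ k})

theorem multiChooseSpan_mono {d k l : ℕ} (h : k ≤ l) :
    multiChooseSpan d k ≤ multiChooseSpan d l :=
  Submodule.span_mono (Set.image_mono fun _ hβ => le_trans hβ h)

theorem multiChoose_mem {d k : ℕ} {β : Fin (d + 1) → ℕ} (h : ∑ i, β i ≤ k) :
    (fun x => (multiChoose β x : ℝ)) ∈ multiChooseSpan d k :=
  Submodule.subset_span ⟨β, h, rfl⟩

/-- Coordinatewise this is `(x - b) (x choose b) = (b + 1) (x choose (b + 1))`, written without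
subtraction. -/
theorem coord_mul_multiChoose {d : ℕ} (β x : Fin (d + 1) → ℕ) (i : Fin (d + 1)) :
    x i * multiChoose β x
      = (β i + 1) * multiChoose (β + Pi.single i 1) x + β i * multiChoose β x := by
  obtain ⟨β', hβ'⟩ : ∃ β', β' = β + Pi.single i 1 := ⟨_, rfl⟩
  have hi : β' i = β i + 1 := by simp [hβ']
  have hj : ∀ j ∈ Finset.univ.erase i, β' j = β j := fun j hj => by
    simp [hβ', Finset.ne_of_mem_erase hj]
  rw [← hβ']
  simp only [multiChoose]
  rw [← Finset.mul_prod_erase Finset.univ (fun j => (x j).choose (β j)) (Finset.mem_univ i),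
    ← Finset.mul_prod_erase Finset.univ (fun j => (x j).choose (β' j)) (Finset.mem_univ i)]
  have : ∏ j ∈ Finset.univ.erase i, (x j).choose (β' j)
      = ∏ j ∈ Finset.univ.erase i, (x j).choose (β j) :=
    Finset.prod_congr rfl fun j h => by rw [hj j h]
  have h2 : x i * (x i).choose (β i)
      = (β i + 1) * (x i).choose (β i + 1) + β i * (x i).choose (β i) := by
    have := Nat.choose_succ_right_eq (x i) (β i)
    rcases le_or_gt (β i) (x i) with h | h
    · obtain ⟨t, ht⟩ := Nat.exists_eq_add_of_le h
      rw [ht] at this ⊢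
      rw [Nat.add_sub_cancel_left] at this
      linarith
    · rw [Nat.choose_eq_zero_of_lt h, Nat.choose_eq_zero_of_lt (by omega)]
      simp
  rw [this, ← mul_assoc, h2]
  rw [hi]
  ring

theorem coord_mul_mem {d k : ℕ} (i : Fin (d + 1)) {g : (Fin (d + 1) → ℕ) → ℝ}
    (hg : g ∈ multiChooseSpan d k) : (fun x => (x i : ℝ) * g x) ∈ multiChooseSpan d (k + 1) := by
  induction hg using Submodule.span_induction with
  | mem g hg =>
    obtain ⟨β, hβ, rfl⟩ := hg
    have e : (fun x : Fin (d + 1) → ℕ => (x i : ℝ) * (multiChoose β x : ℝ))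
        = ((β i : ℝ) + 1) • (fun x => (multiChoose (β + Pi.single i 1) x : ℝ))
          + (β i : ℝ) • fun x => (multiChoose β x : ℝ) := by
      funext x
      simp only [Pi.add_apply, Pi.smul_apply, smul_eq_mul]
      exact_mod_cast coord_mul_multiChoose β x i
    simp only
    rw [e]
    refine Submodule.add_mem _ (Submodule.smul_mem _ _ (multiChoose_mem ?_))
      (Submodule.smul_mem _ _ (multiChoose_mem (Nat.le_succ_of_le hβ)))
    simpa [Finset.sum_add_distrib] using hβ
  | zero =>
    convert Submodule.zero_mem (multiChooseSpan d (k + 1)) using 1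
    funext x
    simp
  | add g g' _ _ h h' =>
    convert Submodule.add_mem _ h h' using 1
    funext x
    simp [mul_add]
  | smul a g _ h =>
    convert Submodule.smul_mem _ a h using 1
    funext x
    simp [mul_left_comm]

/-- Iterates multiplication by one coordinate. Quantifying over `k` and `g` lets a product of
monomials be applied one factor after the other. -/
theorem monomial_mul_mem {d : ℕ} (s : Fin d →₀ ℕ) : ∀ {k : ℕ} {g : (Fin (d + 1) → ℕ) → ℝ},
    g ∈ multiChooseSpan d k →
      (fun x => (s.prod fun i e => (x i.castSucc : ℝ) ^ e) * g x)
        ∈ multiChooseSpan d (k + s.degree) := by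
  induction s using Finsupp.induction_linear with
  | zero => simp
  | add s t hs ht =>
    intro k g hg
    have := hs (ht hg)
    rw [map_add, add_comm s.degree, ← add_assoc]
    convert this using 2 with x
    rw [Finsupp.prod_add_index' (by simp) (by simp [pow_add]), mul_assoc]
  | single i a =>
    intro k g hg
    simp only [Finsupp.prod_single_index, pow_zero, Finsupp.degree_single]
    induction a with
    | zero => simpa using hg
    | succ a ih =>
      rw [← add_assoc]
      convert coord_mul_mem i.castSucc ih using 2 with x
      rw [pow_succ', mul_assoc]

theorem gridEval_mem_multiChooseSpan {d k : ℕ} {f : MvPolynomial (Fin d) ℝ}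
    (hf : f.totalDegree ≤ k) : gridEval f ∈ multiChooseSpan d k := by
  have e : gridEval f = ∑ s ∈ f.support, f.coeff s •
      fun x : Fin (d + 1) → ℕ => (s.prod fun i e => (x i.castSucc : ℝ) ^ e) * 1 := by
    funext x
    simp [gridEval, MvPolynomial.eval_eq, Finset.sum_apply, Finsupp.prod]
  rw [e]
  refine Submodule.sum_mem _ fun s hs => Submodule.smul_mem _ _ ?_
  have h1 : (fun _ => 1 : (Fin (d + 1) → ℕ) → ℝ) ∈ multiChooseSpan d 0 := by
    convert multiChoose_mem (d := d) (β := 0) (k := 0) (by simp) using 2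
    simp [multiChoose]
  refine multiChooseSpan_mono ?_ (monomial_mul_mem s h1)
  rw [zero_add]
  exact (MvPolynomial.le_totalDegree hs).trans hf

/-! ### Shifted monomials: degree, grid values and pairings -/

theorem totalDegree_homCoord_le (d N : ℕ) (i : Fin (d + 1)) :
    (homCoord d N i).totalDegree ≤ 1 := by
  refine Fin.lastCases ?_ (fun j => ?_) i
  · rw [homCoord, Fin.snoc_last]
    refine (MvPolynomial.totalDegree_sub _ _).trans (max_le (by rw [MvPolynomial.totalDegree_C]; exact Nat.zero_le _) ?_)
    exact MvPolynomial.totalDegree_finsetSum_le fun j _ => (MvPolynomial.totalDegree_X j).le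
  · rw [homCoord, Fin.snoc_castSucc]
    exact (MvPolynomial.totalDegree_X j).le

theorem totalDegree_aeval_ascPochhammer_le {σ : Type*} {p : MvPolynomial σ ℝ}
    (hp : p.totalDegree ≤ 1) (k : ℕ) :
    (Polynomial.aeval p (ascPochhammer ℝ k)).totalDegree ≤ k := by
  induction k with
  | zero => simp
  | succ k ih =>
    rw [ascPochhammer_succ_right, map_mul]
    refine (MvPolynomial.totalDegree_mul _ _).trans (add_le_add ih ?_)
    rw [map_add, Polynomial.aeval_X, map_natCast]
    refine (MvPolynomial.totalDegree_add _ _).trans (max_le hp ?_)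
    rw [← map_natCast (MvPolynomial.C (R := ℝ) (σ := σ)), MvPolynomial.totalDegree_C]
    exact Nat.zero_le _

theorem totalDegree_shiftedMonomial_le {d : ℕ} (N : ℕ) (α : Fin (d + 1) → ℕ) :
    (shiftedMonomial N α).totalDegree ≤ ∑ i, α i := by
  rw [shiftedMonomial]
  refine (MvPolynomial.totalDegree_mul _ _).trans ?_
  have h1 : ((-1 : MvPolynomial (Fin d) ℝ) ^ (∑ i, α i)).totalDegree = 0 := by
    refine Nat.le_zero.mp ((MvPolynomial.totalDegree_pow _ _).trans ?_)
    simp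
  rw [h1, zero_add]
  refine (MvPolynomial.totalDegree_finsetProd _ _).trans (Finset.sum_le_sum fun i _ => ?_)
  refine totalDegree_aeval_ascPochhammer_le ?_ _
  rw [MvPolynomial.totalDegree_neg]
  exact totalDegree_homCoord_le d N i

theorem poch_neg_natCast (x k : ℕ) : poch (-(x : ℝ)) k = (-1) ^ k * x.descFactorial k := by
  rw [poch, ascPochhammer_eval_neg_eq_descPochhammer, descPochhammer_eval_eq_descFactorial]

theorem gridEval_shiftedMonomial_eq_multiChoose {d N : ℕ} (α : Fin (d + 1) → ℕ)
    {x : Fin (d + 1) → ℕ} (hx : x ∈ simplexGrid d N) :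
    gridEval (shiftedMonomial N α) x = multiFactorial α * multiChoose α x := by
  rw [gridEval_shiftedMonomial α x hx]
  simp only [poch_neg_natCast, Finset.prod_mul_distrib, Finset.prod_pow_eq_pow_sum,
    Nat.descFactorial_eq_factorial_mul_choose]
  rw [← mul_assoc, ← mul_pow]
  simp [multiFactorial, multiChoose, Finset.prod_mul_distrib]

theorem krawtchoukInner_comm {d : ℕ} (c : ℝ) (ρ : Fin d → ℝ) (N : ℕ)
    (f g : MvPolynomial (Fin d) ℝ) : krawtchoukInner c ρ N f g = krawtchoukInner c ρ N g f := by
  simp only [krawtchoukInner, mul_comm (gridEval f _)]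

theorem krawtchoukInner_shiftedMonomial {d : ℕ} (c : ℝ) (ρ : Fin d → ℝ) (N : ℕ)
    (f : MvPolynomial (Fin d) ℝ) (α : Fin (d + 1) → ℕ) :
    krawtchoukInner c ρ N f (shiftedMonomial N α) = c * (multiFactorial α *
      ∑ x ∈ simplexGrid d N, gridEval f x * multiChoose α x * krawtchoukWeight ρ x) := by
  rw [krawtchoukInner, Finset.mul_sum (a := multiFactorial α)]
  congr 1
  refine Finset.sum_congr rfl fun x hx => ?_
  rw [gridEval_shiftedMonomial_eq_multiChoose α hx]
  ring

/-- `m_γ` has degree at most `|γ| < n`, so it is an admissible test polynomial, and it equals `γ!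
C_γ` on the grid. -/
theorem sum_mul_multiChoose_eq_zero {d N n : ℕ} {c : ℝ} {ρ : Fin d → ℝ} (hc : c ≠ 0)
    {r : MvPolynomial (Fin d) ℝ} (hr : r ∈ krawtchoukSpace c ρ N n) {γ : Fin (d + 1) → ℕ}
    (hγ : ∑ i, γ i < n) :
    ∑ x ∈ simplexGrid d N, gridEval r x * multiChoose γ x * krawtchoukWeight ρ x = 0 := by
  have h := hr.2 _ ((totalDegree_shiftedMonomial_le N γ).trans_lt hγ)
  rw [krawtchoukInner_shiftedMonomial] at h
  exact (mul_eq_zero.mp ((mul_eq_zero.mp h).resolve_left hc)).resolve_left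
    (multiFactorial_pos γ).ne'

/-! ### The polarized summation identity -/

/-- If `R` annihilates all `∏ i, (x_i choose γ_i)` with `|γ| < |β|`, only the leading term of the
Vandermonde expansion of `∏ i, (α_i + z_i choose β_i)` contributes. -/
theorem sum_multiChoose_add_mul {d N m : ℕ} (u : (Fin (d + 1) → ℕ) → ℝ)
    (β z : Fin (d + 1) → ℕ) (hβ : ∑ i, β i ≤ m)
    (hu : ∀ γ : Fin (d + 1) → ℕ, ∑ i, γ i < ∑ i, β i →
      ∑ x ∈ simplexGrid d N, multiChoose γ x * u x = 0) :
    ∑ α ∈ simplexGrid d m, (multiChoose β (α + z) : ℝ) *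
        ∑ x ∈ simplexGrid d N, multiChoose α x * u x
      = (N - ∑ i, β i).choose (m - ∑ i, β i) *
        ∑ x ∈ simplexGrid d N, multiChoose β x * u x := by
  have hC : ∀ γ : Fin (d + 1) → ℕ, ∑ i, γ i ≤ m →
      ∑ α ∈ simplexGrid d m, (multiChoose γ α : ℝ) * ∑ x ∈ simplexGrid d N, multiChoose α x * u x
        = (N - ∑ i, γ i).choose (m - ∑ i, γ i) *
          ∑ x ∈ simplexGrid d N, multiChoose γ x * u x := by
    intro γ hγ
    simp only [Finset.mul_sum]
    rw [Finset.sum_comm]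
    refine Finset.sum_congr rfl fun x hx => ?_
    simp only [← mul_assoc, ← Finset.sum_mul]
    congr 1
    exact_mod_cast sum_simplexGrid_multiChoose_mul γ x (mem_simplexGrid.mp hx) hγ
  have hle : ∀ q ∈ Fintype.piFinset fun i => Finset.HasAntidiagonal.antidiagonal (β i),
      ∀ i, (q i).1 + (q i).2 = β i := fun q hq i =>
    Finset.HasAntidiagonal.mem_antidiagonal.mp (Fintype.mem_piFinset.mp hq i)
  simp only [multiChoose_add, Nat.cast_sum, Nat.cast_mul, Finset.sum_mul (s := Fintype.piFinset _)]
  -- The surviving splitting of `β` gives everything to `α` and nothing to `z`; any other one has a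
  -- first part of smaller degree.
  rw [Finset.sum_comm, Finset.sum_eq_single fun i => (β i, 0)]
  · rw [← hC β hβ]
    refine Finset.sum_congr rfl fun α _ => ?_
    simp [multiChoose]
  · intro q hq hne
    have hlt : ∑ i, (q i).1 < ∑ i, β i := by
      refine Finset.sum_lt_sum (fun i _ => by have := hle q hq i; omega) ?_
      by_contra! hall
      refine hne (funext fun i => ?_)
      have h1 := hall i (Finset.mem_univ i)
      have h2 := hle q hq i
      exact Prod.ext (by simp; omega) (by simp; omega)
    calc _ = (multiChoose (fun i => (q i).2) z : ℝ) * ∑ α ∈ simplexGrid d m,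
          (multiChoose (fun i => (q i).1) α : ℝ) *
            ∑ x ∈ simplexGrid d N, multiChoose α x * u x := by
          rw [Finset.mul_sum]
          exact Finset.sum_congr rfl fun α _ => by ring
      _ = 0 := by rw [hC _ (hlt.le.trans hβ), hu _ hlt, mul_zero, mul_zero]
  · intro h
    exact absurd (Fintype.mem_piFinset.mpr fun i => by simp) h

/-- Linearity in `g` is the reason for allowing any element of the span: only one argument has to be
orthogonal to lower degrees, so the other can be reduced to a single `C_β`. -/
theorem sum_div_krawtchoukWeight {d N m n : ℕ} {c : ℝ} {ρ : Fin d → ℝ} (hc : c ≠ 0)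
    (hρ : ∀ i, 0 < ρ i) (hρ' : ∑ i, ρ i < 1) (hnm : n ≤ m) (hmN : m ≤ N)
    {r : MvPolynomial (Fin d) ℝ} (hr : r ∈ krawtchoukSpace c ρ N n)
    {g : (Fin (d + 1) → ℕ) → ℝ} (hg : g ∈ multiChooseSpan d n) :
    ∑ α ∈ simplexGrid d m, (krawtchoukWeight ρ α)⁻¹ *
        (∑ x ∈ simplexGrid d N, g x * multiChoose α x * krawtchoukWeight ρ x) *
        (∑ x ∈ simplexGrid d N, gridEval r x * multiChoose α x * krawtchoukWeight ρ x)
      = (N - n).choose (m - n) / ((N - m).factorial : ℝ) *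
        ∑ x ∈ simplexGrid d N, g x * gridEval r x * krawtchoukWeight ρ x := by
  induction hg using Submodule.span_induction with
  | mem g hg =>
    obtain ⟨β, hβ, rfl⟩ := hg
    have hβ : ∑ i, β i ≤ n := hβ
    set u : (Fin (d + 1) → ℕ) → ℝ := fun x => gridEval r x * krawtchoukWeight ρ x with hu
    have hu1 : ∀ γ : Fin (d + 1) → ℕ,
        ∑ x ∈ simplexGrid d N, gridEval r x * multiChoose γ x * krawtchoukWeight ρ x
          = ∑ x ∈ simplexGrid d N, multiChoose γ x * u x := fun γ =>
      Finset.sum_congr rfl fun x _ => by simp only [hu]; ring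
    have hu0 : ∀ γ : Fin (d + 1) → ℕ, ∑ i, γ i < n →
        ∑ x ∈ simplexGrid d N, multiChoose γ x * u x = 0 := fun γ h => by
      rw [← hu1, sum_mul_multiChoose_eq_zero hc hr h]
    have hu2 : ∑ x ∈ simplexGrid d N, (multiChoose β x : ℝ) * gridEval r x * krawtchoukWeight ρ x
        = ∑ x ∈ simplexGrid d N, multiChoose β x * u x :=
      Finset.sum_congr rfl fun x _ => by simp only [hu]; ring
    rw [hu2]
    calc _ = ∑ α ∈ simplexGrid d m, ∑ z ∈ simplexGrid d (N - m), krawtchoukWeight ρ z *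
          ((multiChoose β (α + z) : ℝ) * ∑ x ∈ simplexGrid d N, multiChoose α x * u x) := by
          refine Finset.sum_congr rfl fun α hα => ?_
          rw [sum_simplexGrid_mul_multiChoose_mul_krawtchoukWeight hmN ρ
            (fun x => (multiChoose β x : ℝ)) hα,
            inv_mul_cancel_left₀ (krawtchoukWeight_pos hρ hρ' α).ne', hu1, Finset.sum_mul]
          exact Finset.sum_congr rfl fun z _ => by ring
      _ = ∑ z ∈ simplexGrid d (N - m), krawtchoukWeight ρ z *
          ((N - ∑ i, β i).choose (m - ∑ i, β i) *
            ∑ x ∈ simplexGrid d N, multiChoose β x * u x) := by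
          rw [Finset.sum_comm]
          refine Finset.sum_congr rfl fun z _ => ?_
          rw [← Finset.mul_sum, sum_multiChoose_add_mul u β z (hβ.trans hnm)
            fun γ h => hu0 γ (h.trans_le hβ)]
      _ = 1 / ((N - m).factorial : ℝ) * ((N - ∑ i, β i).choose (m - ∑ i, β i) *
            ∑ x ∈ simplexGrid d N, multiChoose β x * u x) := by
          rw [← Finset.sum_mul, ← sum_simplexGrid_multiPow_div _ (sum_extParam ρ)]
          rfl
      _ = _ := by
          -- For `|β| < n` both sides vanish by orthogonality, so the binomial factor may be taken
          -- with `n` in place of `|β|`.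
          rcases hβ.lt_or_eq with h | h
          · rw [hu0 β h]
            simp
          · rw [h]
            ring
  | zero => simp
  | add g g' _ _ h h' =>
    simp only [Pi.add_apply, add_mul, Finset.sum_add_distrib, mul_add, h, h']
  | smul a g _ h =>
    simp only [Pi.smul_apply, smul_eq_mul, mul_assoc, ← Finset.mul_sum] at h ⊢
    simp only [mul_left_comm _ a, ← Finset.mul_sum, h]

/-! ### The frame constant -/

/-- Since `(-a)_k = (-1)^k a! / (a - k)!` for `k ≤ a`, the signs cancel in `(-N)_n / (-m)_n` and in
the square, leaving a quotient of factorials. -/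
theorem krawtchoukFrameConst_eq {N m n : ℕ} (c : ℝ) (hnm : n ≤ m) (hmN : m ≤ N) :
    krawtchoukFrameConst c N m n
      = (c * ((N - n).choose (m - n) / ((N - m).factorial : ℝ)))⁻¹ := by
  have h1 : (N.descFactorial n : ℝ) = N.factorial / (N - n).factorial := by
    rw [eq_div_iff (by positivity), mul_comm]
    exact_mod_cast Nat.factorial_mul_descFactorial (hnm.trans hmN)
  have h2 : (m.descFactorial n : ℝ) = m.factorial / (m - n).factorial := by
    rw [eq_div_iff (by positivity), mul_comm]
    exact_mod_cast Nat.factorial_mul_descFactorial hnm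
  have h3 : (N.descFactorial m : ℝ) = N.factorial / (N - m).factorial := by
    rw [eq_div_iff (by positivity), mul_comm]
    exact_mod_cast Nat.factorial_mul_descFactorial hmN
  have h4 : ((N - n).choose (m - n) : ℝ)
      = (N - n).factorial / ((m - n).factorial * (N - m).factorial) := by
    rw [Nat.cast_choose ℝ (by omega), show N - n - (m - n) = N - m by omega]
  have h5 : ((-1 : ℝ) ^ m) ^ 2 = 1 := by rw [← pow_mul, mul_comm, pow_mul]; simp
  have h6 : ((-1 : ℝ) ^ n) ≠ 0 := pow_ne_zero _ (by norm_num)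
  rw [krawtchoukFrameConst, poch_neg_natCast, poch_neg_natCast, poch_neg_natCast, mul_pow, h5, h1,
    h2, h3, h4]
  have := Nat.factorial_ne_zero
  -- With division by zero equal to zero, both sides are `0` here.
  by_cases hc : c = 0
  · simp [hc]
  field_simp

theorem krawtchoukFrameConst_pos {N m n : ℕ} {c : ℝ} (hc : 0 < c) (hnm : n ≤ m) (hmN : m ≤ N) :
    0 < krawtchoukFrameConst c N m n := by
  have : 0 < (N - n).choose (m - n) := Nat.choose_pos (by omega)
  rw [krawtchoukFrameConst_eq c hnm hmN]
  positivity

/-! ### Frame coefficients and the reproducing identity -/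

theorem krawtchoukL_mem {d N n : ℕ} {c : ℝ} {ρ : Fin d → ℝ} (hc : 0 < c) (hρ : ∀ i, 0 < ρ i)
    (hρ' : ∑ i, ρ i < 1) (hn : n ≤ N) (α : Fin (d + 1) → ℕ) :
    krawtchoukL c ρ N n α ∈ krawtchoukSpace c ρ N n :=
  Submodule.smul_mem _ _ (krawtchoukProj_spec hc hρ hρ' hn _).1

theorem krawtchoukInner_smul_right {d : ℕ} (c : ℝ) (ρ : Fin d → ℝ) (N : ℕ) (a : ℝ)
    (f g : MvPolynomial (Fin d) ℝ) :
    krawtchoukInner c ρ N f (a • g) = a * krawtchoukInner c ρ N f g :=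
  (krawtchoukForm c ρ N f).map_smul a g

/-- The projection error is orthogonal to `f`, so `m_α` may replace its projection; the factor `α!
𝛒^{-α}` is `W(α)⁻¹`. -/
theorem krawtchoukInner_krawtchoukL {d N n : ℕ} {c : ℝ} {ρ : Fin d → ℝ} (hc : 0 < c)
    (hρ : ∀ i, 0 < ρ i) (hρ' : ∑ i, ρ i < 1) (hn : n ≤ N) {f : MvPolynomial (Fin d) ℝ}
    (hf : f ∈ krawtchoukSpace c ρ N n) (α : Fin (d + 1) → ℕ) :
    krawtchoukInner c ρ N f (krawtchoukL c ρ N n α) = c * (krawtchoukWeight ρ α)⁻¹ *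
      ∑ x ∈ simplexGrid d N, gridEval f x * multiChoose α x * krawtchoukWeight ρ x := by
  have h1 := (krawtchoukProj_spec hc hρ hρ' hn (shiftedMonomial N α)).2 f hf
  have h2 : krawtchoukInner c ρ N f (shiftedMonomial N α - krawtchoukProj c ρ N n
        (shiftedMonomial N α)) = krawtchoukInner c ρ N f (shiftedMonomial N α)
      - krawtchoukInner c ρ N f (krawtchoukProj c ρ N n (shiftedMonomial N α)) :=
    (krawtchoukForm c ρ N f).map_sub _ _
  rw [krawtchoukInner_comm, h2, sub_eq_zero, krawtchoukInner_shiftedMonomial] at h1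
  rw [krawtchoukL, krawtchoukInner_smul_right, ← h1, krawtchoukWeight, inv_div]
  ring

/-- The polarized Parseval identity: `r = f` gives the norm formula, and general `r` identifies the
expansion of `f` weakly. -/
theorem krawtchoukFrameConst_mul_sum {d N m n : ℕ} {c : ℝ} {ρ : Fin d → ℝ} (hc : 0 < c)
    (hρ : ∀ i, 0 < ρ i) (hρ' : ∑ i, ρ i < 1) (hnm : n ≤ m) (hmN : m ≤ N)
    {f r : MvPolynomial (Fin d) ℝ} (hf : f ∈ krawtchoukSpace c ρ N n)
    (hr : r ∈ krawtchoukSpace c ρ N n) :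
    krawtchoukFrameConst c N m n * ∑ α ∈ simplexGrid d m,
        multiPow (extParam ρ) α / multiFactorial α *
          krawtchoukInner c ρ N f (krawtchoukL c ρ N n α) *
          krawtchoukInner c ρ N r (krawtchoukL c ρ N n α)
      = krawtchoukInner c ρ N f r := by
  have h := sum_div_krawtchoukWeight hc.ne' hρ hρ' hnm hmN hr (gridEval_mem_multiChooseSpan hf.1)
  have h2 : ∑ α ∈ simplexGrid d m, multiPow (extParam ρ) α / multiFactorial α *
          krawtchoukInner c ρ N f (krawtchoukL c ρ N n α) *
          krawtchoukInner c ρ N r (krawtchoukL c ρ N n α)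
      = c ^ 2 * ((N - n).choose (m - n) / ((N - m).factorial : ℝ) *
        ∑ x ∈ simplexGrid d N, gridEval f x * gridEval r x * krawtchoukWeight ρ x) := by
    rw [← h, Finset.mul_sum]
    refine Finset.sum_congr rfl fun α _ => ?_
    rw [krawtchoukInner_krawtchoukL hc hρ hρ' (hnm.trans hmN) hf,
      krawtchoukInner_krawtchoukL hc hρ hρ' (hnm.trans hmN) hr]
    change krawtchoukWeight ρ α * _ * _ = _
    have := (krawtchoukWeight_pos hρ hρ' α).ne'
    field_simp
  have h3 : ((N - n).choose (m - n) : ℝ) ≠ 0 :=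
    Nat.cast_ne_zero.mpr (Nat.choose_pos (by omega)).ne'
  have := Nat.factorial_ne_zero
  rw [h2, krawtchoukFrameConst_eq c hnm hmN, krawtchoukInner]
  field_simp

theorem theorem5p3 {d : ℕ} (ρ : Fin d → ℝ) (hρ : ∀ i, 0 < ρ i) (hρ' : ∑ i, ρ i < 1)
    (c : ℝ) (hc : 0 < c) (N m n : ℕ) (hnm : n ≤ m) (hmN : m ≤ N) :
    (∀ f ∈ krawtchoukSpace c ρ N n,
      f = krawtchoukFrameConst c N m n •
        ∑ α ∈ simplexGrid d m,
          (multiPow (extParam ρ) α / multiFactorial α *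
            krawtchoukInner c ρ N f (krawtchoukL c ρ N n α)) • krawtchoukL c ρ N n α) ∧
    (∀ f ∈ krawtchoukSpace c ρ N n,
      krawtchoukInner c ρ N f f = krawtchoukFrameConst c N m n *
        ∑ α ∈ simplexGrid d m, multiPow (extParam ρ) α / multiFactorial α *
          krawtchoukInner c ρ N f (krawtchoukL c ρ N n α) ^ 2) ∧
    0 < krawtchoukFrameConst c N m n ∧
    IsTightFrame (krawtchoukInner c ρ N) (krawtchoukSpace c ρ N n) (simplexGrid d m)
      (fun α => √(krawtchoukFrameConst c N m n *
        (multiPow (extParam ρ) α / multiFactorial α)) • krawtchoukL c ρ N n α) := by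
  have hn := hnm.trans hmN
  have hD := krawtchoukFrameConst_pos hc hnm hmN
  have hL := krawtchoukL_mem hc hρ hρ' hn
  have hnorm : ∀ f ∈ krawtchoukSpace c ρ N n,
      krawtchoukInner c ρ N f f = krawtchoukFrameConst c N m n *
        ∑ α ∈ simplexGrid d m, multiPow (extParam ρ) α / multiFactorial α *
          krawtchoukInner c ρ N f (krawtchoukL c ρ N n α) ^ 2 := by
    intro f hf
    rw [← krawtchoukFrameConst_mul_sum hc hρ hρ' hnm hmN hf hf]
    simp only [sq, mul_assoc]
  refine ⟨fun f hf => ?_, hnorm, hD, fun α _ => Submodule.smul_mem _ _ (hL α), fun f hf => ?_⟩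
  · set F := krawtchoukFrameConst c N m n • ∑ α ∈ simplexGrid d m,
      (multiPow (extParam ρ) α / multiFactorial α *
        krawtchoukInner c ρ N f (krawtchoukL c ρ N n α)) • krawtchoukL c ρ N n α with hF
    have hFV : F ∈ krawtchoukSpace c ρ N n :=
      Submodule.smul_mem _ _ (Submodule.sum_mem _ fun α _ => Submodule.smul_mem _ _ (hL α))
    -- `F` and `f` pair equally with all of `V_n`. Testing against `f - F`, itself in `V_n`, gives
    -- it norm zero.
    have key : ∀ r ∈ krawtchoukSpace c ρ N n,
        krawtchoukInner c ρ N r F = krawtchoukInner c ρ N r f := by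
      intro r hr
      rw [krawtchoukInner_comm c ρ N r f, ← krawtchoukFrameConst_mul_sum hc hρ hρ' hnm hmN hf hr]
      change krawtchoukForm c ρ N r F = _
      rw [hF, map_smul, map_sum, smul_eq_mul]
      simp only [map_smul, smul_eq_mul]
      rfl
    have hV := Submodule.sub_mem _ hf hFV
    refine sub_eq_zero.mp (eq_zero_of_krawtchoukInner_self hc hρ hρ' (hV.1.trans hn) ?_)
    change krawtchoukForm c ρ N (f - F) (f - F) = 0
    rw [map_sub (krawtchoukForm c ρ N (f - F))]
    exact sub_eq_zero.mpr (key _ hV).symm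
  · rw [hnorm f hf, Finset.mul_sum]
    refine Finset.sum_congr rfl fun α _ => ?_
    rw [krawtchoukInner_smul_right, mul_pow, Real.sq_sqrt, mul_assoc]
    exact mul_nonneg hD.le
      (div_pos (multiPow_pos (extParam_pos hρ hρ') α) (multiFactorial_pos α)).le
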